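/- **Setting.** Let $K$ be a field and let $[X]$ be a commutative cancellative monoid of power-products in which $1$ is the only invertible element, any two elements have a least common multiple, and which admits a Dickson grading, i.e. a map $d:[X]\to\mathbb N$ with $d(st)=\max(d(s),d(t))$ such that for every $m$ and every sequence $(s_i)_{i\in\mathbb N}$ with $d(s_i)\le m$ there are $i<j$ with $s_i\mid s_j$. (This covers the power-products in finitely or countably many indeterminates.) Let $K[X]$ be the monoid algebra of $[X]$ over $K$, let $\kappa\neq\emptyset$ be a well-ordered index set (e.g. $\kappa=\{0,\dots,k-1\}$ with $k\ge 1$), and let $K[X]^{\kappa}$ be the free $K[X]$-module with basis $(e_i)_{i\in\kappa}$ (so $K[X]^{\kappa}=K[x_0,\dots,x_{n-1}]^k$ in the classical case). Fix a linear order $\preceq$ on $[X]$ with least element $1$ such that $s\preceq t$ implies $su\preceq tu$, and a linear order $\preceq_{\mathsf t}$ on the terms $t\,e_i$ ($t\in[X]$, $i\in\kappa$) such that $s\,e_i\preceq_{\mathsf t}t\,e_j$ implies $us\,e_i\preceq_{\mathsf t}ut\,e_j$, and $s\preceq t$, $i\le j$ imply $s\,e_i\preceq_{\mathsf t}t\,e_j$.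 For $p\ne0$ let $\mathrm{lt}(p)$ be the $\preceq_{\mathsf t}$-largest term of $p$ and $\mathrm{lc}(p)$ its coefficient; $\mathrm{pmdl}(B)$ is the submodule generated by $B$; a term $s\,e_i$ divides $t\,e_j$ iff $i=j$ and $s\mid t$. For a set $F$, $p\to_F q$ means that there are $0\ne f\in F$ with $\mathrm{lt}(f)=s\,e_j$ and $t\in[X]$ such that the coefficient $c$ of $ts\,e_j$ in $p$ is non-zero and $q=p-\frac{c}{\mathrm{lc}(f)}\,t f$. A set $G$ is a *Gröbner basis* if $\to_G$ is confluent. It is a *reduced Gröbner basis* if moreover no $b\in G$ is reducible modulo $G\setminus\{b\}$, $\mathrm{lc}(b)=1$ for all $b\in G$, and $0\notin G$. For a finite list $fs$, $\mathrm{trd}(fs,p)$ is the total reduction of $p$: its terms are processed in descending order, and each one is cancelled using the first non-zero $f$ in $fs$ whose leading term divides it, or else moved to the result. For a finite list $xs$, $\mathrm{comp\_red\_monic\_basis}(xs)$ is computed as follows: (1) remove all zeros and then, going through the list, every element whose leading term is divisible by the leading term of another element still present; (2) going through the list, replace every element $x$ by $\mathrm{trd}(fs,x)$, where $fs$ is the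 list of all other current elements; (3) divide every element by its leading coefficient. **Theorem.** 1. If $A,B\subseteq K[X]^{\kappa}$ are reduced Gröbner bases with $\mathrm{pmdl}(A)=\mathrm{pmdl}(B)$, then $A=B$. 2. If $xs$ is a finite list whose set of elements is a Gröbner basis, then the set of elements of $\mathrm{comp\_red\_monic\_basis}(xs)$ is a reduced Gröbner basis, and it generates the same submodule as $xs$. 3. For every finitely generated submodule $N$ of $K[X]^{\kappa}$ there is exactly one reduced Gröbner basis $G$ with $\mathrm{pmdl}(G)=N$. -/

import Mathlib

/-!
Gröbner bases of submodules of free modules over polynomial rings.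

Power-products are written additively: the monoid operation of `α` is `+`, the power-product `1`
is `0`, and divisibility of power-products is `Adds`.  For `α = (σ →₀ ℕ)` the ring
`AddMonoidAlgebra K α` is `MvPolynomial σ K`.
-/

noncomputable section

set_option linter.unusedSectionVars false

namespace ModuleGB

/-! ### Power-products -/

/-- Divisibility of (additively written) power-products. -/
def Adds {α : Type*} [Add α] (s t : α) : Prop := ∃ u, t = s + u

/-- `d` is a Dickson grading: it turns products into maxima, and below every bound divisibility of
power-products is almost full (every sequence `s` has `i < j` with `s i` dividing `s j`). -/
structure IsDicksonGrading {α : Type*} [Add α] (d : α → ℕ) : Prop where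
  map_add : ∀ s t, d (s + t) = max (d s) (d t)
  dickson : ∀ n : ℕ, {t | d t ≤ n}.PartiallyWellOrderedOn Adds

/-- Cancellative commutative monoids of power-products: `0` (the power-product `1`) is the only
invertible element, least common multiples exist, and there is a Dickson grading. -/
class GradedDicksonPowerprod (α : Type*) [AddCommMonoid α] : Prop extends IsCancelAdd α where
  eq_zero_of_add : ∀ s t : α, s + t = 0 → s = 0
  exists_lcm : ∀ s t : α, ∃ l, Adds s l ∧ Adds t l ∧ ∀ u, Adds s u → Adds t u → Adds l u
  exists_grading : ∃ d : α → ℕ, IsDicksonGrading d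

/-- The power-products in finitely or countably many indeterminates. -/
instance {σ : Type*} [Countable σ] : GradedDicksonPowerprod (σ →₀ ℕ) where
  eq_zero_of_add s t h := by
    ext i
    have := DFunLike.congr_fun h i
    simp at this
    simp [this.1]
  exists_lcm s t := by
    have key : ∀ a b : σ →₀ ℕ, Adds a b ↔ a ≤ b := fun a b => le_iff_exists_add.symm
    refine ⟨s ⊔ t, (key _ _).2 le_sup_left, (key _ _).2 le_sup_right, fun u hs ht => ?_⟩
    exact (key _ _).2 (sup_le ((key _ _).1 hs) ((key _ _).1 ht))
  exists_grading := by
    classical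
    obtain ⟨e, he⟩ := exists_injective_nat σ
    refine ⟨fun t => t.support.sup fun i => e i + 1, ?_, ?_⟩
    · intro s t
      have : (s + t).support = s.support ∪ t.support := by
        ext i
        simp only [Finsupp.mem_support_iff, Finsupp.add_apply, Finset.mem_union]
        omega
      change (s + t).support.sup _ = _
      rw [this, Finset.sup_union]
    · intro n f
      have hfin : Finite {i : σ // e i + 1 ≤ n} :=
        Finite.of_injective (β := Fin n) (fun i => ⟨e i.1, i.2⟩) fun i j h => by
          apply Subtype.ext
          apply he
          simpa using h
      obtain ⟨i, j, hij, hle⟩ := wellQuasiOrdered_le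
        (fun k (a : {i : σ // e i + 1 ≤ n}) => (f k).1 a.1)
      refine ⟨i, j, hij, le_iff_exists_add.1 fun a => ?_⟩
      by_cases ha : e a + 1 ≤ n
      · exact hle ⟨a, ha⟩
      · have hz : (f i).1 a = 0 := by
          by_contra hne
          apply ha
          have h1 : ((f i).1.support.sup fun i => e i + 1) ≤ n := (f i).2
          exact (Finset.le_sup (f := fun i => e i + 1) (Finsupp.mem_support_iff.2 hne)).trans h1
        rw [hz]
        exact Nat.zero_le _

/-! ### Term orders -/

/-- An admissible order `ordP` on the power-products together with an admissible extension `ordT`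
to the terms `t e_i`, which are represented as pairs `(t, i)`. -/
structure TermOrder (α κ : Type*) [AddMonoid α] [LE κ] where
  ordP : LinearOrder α
  ordT : LinearOrder (α × κ)
  zero_min : ∀ t, ordP.le 0 t
  add_mono : ∀ s t u, ordP.le s t → ordP.le (s + u) (t + u)
  stimes_mono : ∀ (v w : α × κ) (t : α), ordT.le v w → ordT.le (t + v.1, v.2) (t + w.1, w.2)
  ord_termI : ∀ v w : α × κ, ordP.le v.1 w.1 → v.2 ≤ w.2 → ordT.le v w

/-! ### Vector-polynomials -/

/-- The free module with basis `e_i` (`i : κ`) over the polynomial ring with power-products `α`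
and coefficients `K`. For `α = (Fin n →₀ ℕ)` and `κ = Fin k` this is `K[x_0, …, x_{n-1}]^k`. -/
abbrev VecPoly (α κ K : Type*) [Semiring K] : Type _ := κ →₀ AddMonoidAlgebra K α

section Basic

variable {α κ K : Type*} [AddCommMonoid α] [Field K]

/-- The coefficient of the term `v` in `p`. -/
def coeff (p : VecPoly α κ K) (v : α × κ) : K := (p v.2).coeff v.1

open scoped Classical in
/-- The finite set of terms that appear in `p` with non-zero coefficient. -/
def keys (p : VecPoly α κ K) : Finset (α × κ) :=
  p.support.biUnion fun i => (p i).coeff.support.image fun t => (t, i)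

theorem mem_keys {p : VecPoly α κ K} {v : α × κ} : v ∈ keys p ↔ coeff p v ≠ 0 := by
  classical
  obtain ⟨t, i⟩ := v
  simp only [keys, coeff, Finset.mem_biUnion, Finset.mem_image, Finsupp.mem_support_iff]
  constructor
  · rintro ⟨j, hj, s, hs, h⟩
    obtain ⟨rfl, rfl⟩ := Prod.mk.inj h
    exact hs
  · intro h
    refine ⟨i, fun h0 => h ?_, t, h, rfl⟩
    simp [h0]

theorem ext_coeff {p q : VecPoly α κ K} (h : ∀ v, coeff p v = coeff q v) : p = q := by
  ext i t
  exact h (t, i)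

theorem keys_nonempty {p : VecPoly α κ K} (hp : p ≠ 0) : (keys p).Nonempty := by
  by_contra h
  apply hp
  apply ext_coeff
  intro v
  by_contra hv
  exact h ⟨v, mem_keys.2 hv⟩

/-- The scalar multiple `c · v` of a term `v`. -/
def monomial (c : K) (v : α × κ) : VecPoly α κ K :=
  Finsupp.single v.2 (AddMonoidAlgebra.single v.1 c)

/-- Multiplication of `p` by the coefficient `c` and the power-product `t`. -/
def monomMult (c : K) (t : α) (p : VecPoly α κ K) : VecPoly α κ K :=
  AddMonoidAlgebra.single t c • p

/-- A term `s e_i` divides a term `t e_j` iff `i = j` and `s` divides `t`. -/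
def TermDvd (v w : α × κ) : Prop := v.2 = w.2 ∧ Adds v.1 w.1

open scoped Classical in
/-- The quotient `t / s` of power-products (if `s` divides `t`). -/
def quot (t s : α) : α := if h : Adds s t then h.choose else 0

theorem quot_spec {s t : α} (h : Adds s t) : quot t s + s = t := by
  rw [quot, dif_pos h, add_comm]
  exact h.choose_spec.symm

theorem coeff_sub (p q : VecPoly α κ K) (v : α × κ) :
    coeff (p - q) v = coeff p v - coeff q v := by
  simp [coeff]

theorem coeff_monomial_self (c : K) (v : α × κ) : coeff (monomial c v) v = c := by
  simp [coeff, monomial]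

theorem coeff_monomial_ne (c : K) {v w : α × κ} (h : v ≠ w) : coeff (monomial c v) w = 0 := by
  classical
  obtain ⟨s, i⟩ := v
  obtain ⟨t, j⟩ := w
  by_cases hij : i = j
  · subst hij
    have hst : s ≠ t := fun e => h (by rw [e])
    simp [coeff, monomial, hst]
  · simp [coeff, monomial, hij]

theorem coeff_monomMult [IsCancelAdd α] (c : K) (t : α) (p : VecPoly α κ K) (v : α × κ) :
    coeff (monomMult c t p) (t + v.1, v.2) = c * coeff p v := by
  simp only [coeff, monomMult, Finsupp.smul_apply, smul_eq_mul]
  exact AddMonoidAlgebra.coeff_single_mul_add (p v.2) c t v.1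

theorem exists_of_coeff_monomMult [IsCancelAdd α] {c : K} {t : α} {p : VecPoly α κ K}
    {w : α × κ}
    (h : coeff (monomMult c t p) w ≠ 0) : ∃ v, w = (t + v.1, v.2) ∧ coeff p v ≠ 0 := by
  by_cases ht : ∃ u, w.1 = t + u
  · obtain ⟨u, hu⟩ := ht
    have hw : w = (t + u, w.2) := Prod.ext hu rfl
    refine ⟨(u, w.2), hw, fun h0 => h ?_⟩
    rw [hw]
    have := coeff_monomMult c t p (u, w.2)
    simp only [h0, mul_zero] at this
    exact this
  · exfalso
    apply h
    simp only [coeff, monomMult, Finsupp.smul_apply, smul_eq_mul]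
    exact AddMonoidAlgebra.coeff_single_mul_of_forall_add_ne c (p w.2)
      fun d hd => ht ⟨d, hd.symm⟩

end Basic

namespace TermOrder

variable {α κ K : Type*} [AddCommMonoid α] [LinearOrder κ] [Nonempty κ] [Field K]

open scoped Classical in
/-- The leading term of `p` (an irrelevant default value for `p = 0`). -/
def lt (o : TermOrder α κ) (p : VecPoly α κ K) : α × κ :=
  if h : (keys p).Nonempty then @Finset.max' _ o.ordT (keys p) h
  else (0, Classical.arbitrary κ)

/-- The leading coefficient of `p`. -/
def lc (o : TermOrder α κ) (p : VecPoly α κ K) : K := coeff p (o.lt p)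

/-- `p` without its leading monomial. -/
def tail (o : TermOrder α κ) (p : VecPoly α κ K) : VecPoly α κ K :=
  p - monomial (o.lc p) (o.lt p)

/-- `p` divided by its leading coefficient. -/
def monic (o : TermOrder α κ) (p : VecPoly α κ K) : VecPoly α κ K := monomMult (1 / o.lc p) 0 p

/-! ### Reduction and Gröbner bases -/

/-- `p` reduces to `q` modulo the single vector-polynomial `f` using the power-product `t`. -/
def RedSingle (o : TermOrder α κ) (p q f : VecPoly α κ K) (t : α) : Prop :=
  f ≠ 0 ∧ coeff p (t + (o.lt f).1, (o.lt f).2) ≠ 0 ∧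
    q = p - monomMult (coeff p (t + (o.lt f).1, (o.lt f).2) / o.lc f) t f

/-- The (one-step) reduction relation modulo the set `F`. -/
def Red (o : TermOrder α κ) (F : Set (VecPoly α κ K)) (p q : VecPoly α κ K) : Prop :=
  ∃ f ∈ F, ∃ t, o.RedSingle p q f t

/-- `p` is reducible modulo `F`. -/
def IsRed (o : TermOrder α κ) (F : Set (VecPoly α κ K)) (p : VecPoly α κ K) : Prop :=
  ∃ q, o.Red F p q

/-- `G` is a Gröbner basis: the reduction relation modulo `G` is confluent. -/
def IsGroebnerBasis (o : TermOrder α κ) (G : Set (VecPoly α κ K)) : Prop :=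
  ∀ p q r, Relation.ReflTransGen (o.Red G) p q → Relation.ReflTransGen (o.Red G) p r →
    Relation.Join (Relation.ReflTransGen (o.Red G)) q r

/-- No element of `B` can be reduced modulo the other elements of `B`. -/
def IsAutoReduced (o : TermOrder α κ) (B : Set (VecPoly α κ K)) : Prop :=
  ∀ b ∈ B, ¬ o.IsRed (B \ {b}) b

/-- Auto-reduced Gröbner bases of non-zero monic vector-polynomials. -/
structure IsReducedGB (o : TermOrder α κ) (B : Set (VecPoly α κ K)) : Prop where
  isGroebnerBasis : o.IsGroebnerBasis B
  isAutoReduced : o.IsAutoReduced B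
  monic : ∀ b ∈ B, o.lc b = 1
  zero_notMem : (0 : VecPoly α κ K) ∉ B

/-! ### Total reduction -/

open scoped Classical in
/-- The first non-zero element of `fs` whose leading term divides `v` (if any). -/
def findDvd (o : TermOrder α κ) (fs : List (VecPoly α κ K)) (v : α × κ) :
    Option (VecPoly α κ K) :=
  fs.find? fun f => decide (f ≠ 0 ∧ TermDvd (o.lt f) v)

/-- One step of the total reduction of `p ≠ 0` modulo `fs`: the leading monomial of `p` is
cancelled by a multiple of the first suitable element of `fs`; if there is none, the leading
monomial is split off. -/
def trdStep (o : TermOrder α κ) (fs : List (VecPoly α κ K)) (p : VecPoly α κ K) :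
    VecPoly α κ K :=
  match o.findDvd fs (o.lt p) with
  | some f => p - monomMult (o.lc p / o.lc f) (quot (o.lt p).1 (o.lt f).1) f
  | none => o.tail p

section Termination

theorem coeff_lt_ne_zero (o : TermOrder α κ) {p : VecPoly α κ K} (hp : p ≠ 0) :
    coeff p (o.lt p) ≠ 0 := by
  rw [lt, dif_pos (keys_nonempty hp)]
  exact mem_keys.1 (@Finset.max'_mem _ o.ordT _ _)

theorem le_lt (o : TermOrder α κ) {p : VecPoly α κ K} {v : α × κ} (hv : coeff p v ≠ 0) :
    o.ordT.le v (o.lt p) := by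
  have h : (keys p).Nonempty := ⟨v, mem_keys.2 hv⟩
  rw [lt, dif_pos h]
  exact @Finset.le_max' _ o.ordT _ _ (mem_keys.2 hv)

theorem findDvd_spec (o : TermOrder α κ) {fs : List (VecPoly α κ K)} {v : α × κ}
    {f : VecPoly α κ K} (h : o.findDvd fs v = some f) :
    f ∈ fs ∧ f ≠ 0 ∧ TermDvd (o.lt f) v := by
  refine ⟨List.mem_of_find?_eq_some h, ?_⟩
  have := List.find?_some h
  simpa using this

/-- A term of `trdStep fs p` is a term of `p` or a multiple of a term of an element of `fs` by a
divisor of the leading term of `p`; it is smaller than the leading term of `p`. -/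
theorem of_mem_trdStep [IsCancelAdd α] (o : TermOrder α κ) {fs : List (VecPoly α κ K)} {p : VecPoly α κ K}
    {w : α × κ} (hw : coeff (o.trdStep fs p) w ≠ 0) :
    (o.ordT.le w (o.lt p) ∧ w ≠ o.lt p) ∧
    (coeff p w ≠ 0 ∨ ∃ f ∈ fs, ∃ v, coeff f v ≠ 0 ∧ ∃ t s, w = (t + v.1, v.2) ∧
      t + s = (o.lt p).1) := by
  unfold trdStep at hw
  split at hw
  next f hf =>
    obtain ⟨hfs, hf0, hcomp, hadds⟩ := o.findDvd_spec hf
    have hq := quot_spec hadds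
    set t := quot (o.lt p).1 (o.lt f).1 with ht
    have hltp : o.lt p = (t + (o.lt f).1, (o.lt f).2) := Prod.ext hq.symm hcomp.symm
    rw [coeff_sub] at hw
    have hor : coeff p w ≠ 0 ∨ coeff (monomMult (o.lc p / o.lc f) t f) w ≠ 0 := by
      by_contra hcon
      push Not at hcon
      rw [hcon.1, hcon.2] at hw
      simp at hw
    refine ⟨⟨?_, ?_⟩, ?_⟩
    · rcases hor with h | h
      · exact o.le_lt h
      · obtain ⟨v, rfl, hv⟩ := exists_of_coeff_monomMult h
        rw [hltp]
        exact o.stimes_mono _ _ _ (o.le_lt hv)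
    · rintro rfl
      apply hw
      have h1 : coeff (monomMult (o.lc p / o.lc f) t f) (o.lt p) = o.lc p / o.lc f * o.lc f := by
        have := coeff_monomMult (o.lc p / o.lc f) t f (o.lt f)
        rw [← hltp] at this
        exact this
      have h2 : o.lc f ≠ 0 := o.coeff_lt_ne_zero hf0
      rw [h1, div_mul_cancel₀ _ h2]
      exact sub_self _
    · rcases hor with h | h
      · exact Or.inl h
      · obtain ⟨v, hwv, hv⟩ := exists_of_coeff_monomMult h
        exact Or.inr ⟨f, hfs, v, hv, t, _, hwv, hq⟩
  next =>
    rw [tail, coeff_sub] at hw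
    have hne : w ≠ o.lt p := by
      rintro rfl
      rw [coeff_monomial_self] at hw
      exact hw (sub_self _)
    rw [coeff_monomial_ne _ hne.symm, sub_zero] at hw
    exact ⟨⟨o.le_lt hw, hne⟩, Or.inl hw⟩

/-- Total reduction terminates. -/
theorem wellFounded_trdStep [GradedDicksonPowerprod α] (o : TermOrder α κ)
    (fs : List (VecPoly α κ K)) :
    WellFounded fun q p : VecPoly α κ K => p ≠ 0 ∧ q = o.trdStep fs p := by
  classical
  rw [wellFounded_iff_isEmpty_descending_chain]
  refine ⟨fun ⟨p, hp⟩ => ?_⟩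
  obtain ⟨d, hd⟩ := GradedDicksonPowerprod.exists_grading (α := α)
  let T : Finset (α × κ) := keys (p 0) ∪ fs.toFinset.biUnion keys
  let m : ℕ := T.sup fun v => d v.1
  let C : Finset κ := T.image Prod.snd
  have hT : ∀ v ∈ T, d v.1 ≤ m ∧ v.2 ∈ C := fun v hv =>
    ⟨Finset.le_sup (f := fun v : α × κ => d v.1) hv, Finset.mem_image_of_mem _ hv⟩
  have hinv : ∀ n v, coeff (p n) v ≠ 0 → d v.1 ≤ m ∧ v.2 ∈ C := by
    intro n
    induction n with
    | zero => exact fun v hv => hT v (Finset.mem_union_left _ (mem_keys.2 hv))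
    | succ n ih =>
      intro w hw
      rw [(hp n).2] at hw
      obtain ⟨-, h | ⟨f, hf, v, hv, t, s, rfl, hts⟩⟩ := o.of_mem_trdStep hw
      · exact ih w h
      · have hv' := hT v (Finset.mem_union_right _
          (Finset.mem_biUnion.2 ⟨f, List.mem_toFinset.2 hf, mem_keys.2 hv⟩))
        have hl := (ih _ (o.coeff_lt_ne_zero (hp n).1)).1
        rw [← hts, hd.map_add] at hl
        refine ⟨?_, hv'.2⟩
        rw [hd.map_add]
        exact max_le ((le_max_left _ _).trans hl) hv'.1
  let ls : ℕ → α × κ := fun n => o.lt (p n)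
  have hls : ∀ n, d (ls n).1 ≤ m ∧ (ls n).2 ∈ C := fun n =>
    hinv n _ (o.coeff_lt_ne_zero (hp n).1)
  let _ := o.ordT
  have hanti : StrictAnti ls := by
    refine strictAnti_nat_of_succ_lt fun n => ?_
    have h := o.coeff_lt_ne_zero (hp (n + 1)).1
    have h' : coeff (o.trdStep fs (p n)) (o.lt (p (n + 1))) ≠ 0 := by
      rw [← (hp n).2]
      exact h
    obtain ⟨⟨h1, h2⟩, -⟩ := o.of_mem_trdStep h'
    exact lt_of_le_of_ne h1 h2
  have hpre : IsPreorder {t : α // t ∈ {t | d t ≤ m}} (Subrel Adds (· ∈ {t | d t ≤ m})) :=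
    { refl := fun a => ⟨0, (add_zero _).symm⟩
      trans := by
        rintro a b c ⟨u, hu⟩ ⟨v, hv⟩
        exact ⟨u + v, by rw [hv, hu, add_assoc]⟩ }
  have hwqo := (show WellQuasiOrdered (Subrel Adds (· ∈ {t | d t ≤ m})) from hd.dickson m).prod
    (Finite.wellQuasiOrdered (α := C) Eq)
  obtain ⟨i, j, hij, ⟨u, hu⟩, h2⟩ := hwqo fun n => (⟨(ls n).1, (hls n).1⟩, ⟨(ls n).2, (hls n).2⟩)
  have h2' : (ls i).2 = (ls j).2 := congrArg Subtype.val h2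
  have hle : ls i ≤ ls j := by
    refine o.ord_termI _ _ ?_ h2'.le
    have h3 := o.add_mono 0 u (ls i).1 (o.zero_min u)
    rw [zero_add, add_comm u] at h3
    have hu' : (ls j).1 = (ls i).1 + u := hu
    rw [hu']
    exact h3
  exact absurd (hanti hij) (not_lt.2 hle)

end Termination

section Algorithm

open scoped Classical in
/-- Total reduction of `p` modulo `fs`: the terms of `p` are processed in descending order, and
each of them is reduced by the first suitable element of `fs` or else moved to the result. -/
def trd [GradedDicksonPowerprod α] (o : TermOrder α κ) (fs : List (VecPoly α κ K)) (p : VecPoly α κ K) :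
    VecPoly α κ K :=
  if _h : p = 0 then 0
  else (if (o.findDvd fs (o.lt p)).isSome then 0 else monomial (o.lc p) (o.lt p)) +
    trd o fs (o.trdStep fs p)
termination_by (o.wellFounded_trdStep fs).wrap p
decreasing_by exact ⟨_h, rfl⟩

open scoped Classical in
/-- Moves the elements of `xs` one by one to `ys`, dropping those whose leading term is divisible
by the leading term of another element that is still present in `xs` or `ys`. -/
def filterMinAux (o : TermOrder α κ) :
    List (VecPoly α κ K) → List (VecPoly α κ K) → List (VecPoly α κ K)
  | [], ys => ys
  | x :: xs, ys =>
    if ∃ y ∈ xs ++ ys, TermDvd (o.lt y) (o.lt x) then filterMinAux o xs ys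
    else filterMinAux o xs (x :: ys)

open scoped Classical in
/-- Removes `0` and all elements whose leading term is divisible by the leading term of another
remaining element. -/
def compMinBasis (o : TermOrder α κ) (xs : List (VecPoly α κ K)) : List (VecPoly α κ K) :=
  o.filterMinAux (xs.filter fun x => decide (x ≠ 0)) []

/-- Replaces the elements of `xs` one by one by their total reductions modulo all other (already
replaced or still unreplaced) elements. -/
def compRedBasisAux [GradedDicksonPowerprod α] (o : TermOrder α κ) :
    List (VecPoly α κ K) → List (VecPoly α κ K) → List (VecPoly α κ K)
  | [], ys => ys
  | x :: xs, ys => compRedBasisAux o xs (o.trd (xs ++ ys) x :: ys)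

/-- The function `comp_red_monic_basis`: remove superfluous elements, totally reduce every
remaining element modulo the others, and make the results monic. -/
def compRedMonicBasis [GradedDicksonPowerprod α] (o : TermOrder α κ)
    (xs : List (VecPoly α κ K)) : List (VecPoly α κ K) :=
  (o.compRedBasisAux (o.compMinBasis xs) []).map o.monic

end Algorithm

end TermOrder

/-- The submodule generated by a set of vector-polynomials. -/
abbrev pmdl {α κ K : Type*} [AddCommMonoid α] [Field K] (B : Set (VecPoly α κ K)) :
    Submodule (AddMonoidAlgebra K α) (VecPoly α κ K) :=
  Submodule.span (AddMonoidAlgebra K α) B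

end ModuleGB

end

set_option linter.unusedSectionVars false

namespace ModuleGB

/-! ### Coefficients, monomial multiples and divisibility of terms. -/

section Basic

variable {α κ K : Type*} [AddCommMonoid α] [Field K]

/-! Everything rests on a criterion in terms of leading terms: every non-zero element of the
generated submodule has a leading term divisible by that of some non-zero generator. Confluence
implies it (`IsGroebnerBasis.exists_termDvd`). For finite lists it implies confluence
(`isGroebnerBasis_of_forall_termDvd`), because total reduction produces normal forms and two normal
forms congruent modulo the submodule must agree.

Uniqueness: an element `a` of one reduced basis is matched with an element `b` of the other having
the same leading term. If `a - b` were non-zero, its leading term would lie strictly below and occur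
in `a` or `b`; but it is divisible by a leading term of either basis, contradicting
auto-reducedness.

Correctness of the algorithm: discarding elements with superfluous leading terms preserves the
criterion. Afterwards no leading term divides another, so interreduction changes neither the leading
terms nor the submodule.

Existence: no critical pairs are needed. Dickson's property only controls power-products of bounded
degree, so it must be shown that leading terms of degree at most the bound `m` of the generators
suffice. Write the power-product of a leading term as `r + s`, with `s` of degree at most `m` and
`r` coprime to everything of degree at most `m` (`exists_split`). The part of the element formed by
the multiples of `r` with cofactor of degree at most `m`, divided by `r`, is again in the submodule
(`exists_mem_pmdl_coeff_eq`), and its leading term has degree at most `m` and divides the given one.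
-/

theorem coeff_zero (v : α × κ) : coeff (0 : VecPoly α κ K) v = 0 := by simp [coeff]

theorem coeff_add (p q : VecPoly α κ K) (v : α × κ) :
    coeff (p + q) v = coeff p v + coeff q v := by
  simp [coeff]

theorem ne_zero_of_coeff {p : VecPoly α κ K} {v : α × κ} (h : coeff p v ≠ 0) : p ≠ 0 := by
  rintro rfl
  exact h (coeff_zero v)

theorem coeff_monomMult_zero [IsCancelAdd α] (c : K) (p : VecPoly α κ K) (v : α × κ) :
    coeff (monomMult c 0 p) v = c * coeff p v := by
  simpa using coeff_monomMult c 0 p v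

theorem monomMult_sub_monomMult (c c' : K) (t : α) (p : VecPoly α κ K) :
    monomMult c t p - monomMult c' t p = monomMult (c - c') t p := by
  rw [monomMult, monomMult, monomMult, AddMonoidAlgebra.single_sub, sub_smul]

theorem monomMult_zero_coeff (t : α) (p : VecPoly α κ K) : monomMult (0 : K) t p = 0 := by
  simp [monomMult]

theorem monomMult_mem {N : Submodule (AddMonoidAlgebra K α) (VecPoly α κ K)} {p : VecPoly α κ K}
    (hp : p ∈ N) (c : K) (t : α) : monomMult c t p ∈ N :=
  N.smul_mem _ hp

/-- Induction over the elements of a submodule, adding monomial multiples of generators. -/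
theorem pmdl_induction {F : Set (VecPoly α κ K)} {P : VecPoly α κ K → Prop} (zero : P 0)
    (step : ∀ q c t, ∀ f ∈ F, P q → P (q + monomMult c t f)) {p : VecPoly α κ K}
    (hp : p ∈ pmdl F) : P p := by
  -- Quantifying over the multiplier and the starting point lets sums be added one summand at a time
  -- and absorbs scalar multiplication into `a`.
  have key : ∀ a : AddMonoidAlgebra K α, ∀ q, P q → P (q + a • p) := by
    induction hp using Submodule.span_induction with
    | mem f hf =>
      intro a
      induction a using AddMonoidAlgebra.induction_linear with
      | zero => intro q hq; simpa using hq
      | add a b ha hb =>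
        intro q hq
        rw [add_smul, ← add_assoc]
        exact hb _ (ha _ hq)
      | single t c => exact fun q hq => step q c t f hf hq
    | zero => intro a q hq; simpa using hq
    | add x y _ _ hx hy =>
      intro a q hq
      rw [smul_add, ← add_assoc]
      exact hy _ _ (hx _ _ hq)
    | smul b x _ hx =>
      intro a q hq
      rw [smul_smul]
      exact hx _ _ hq
  simpa using key 1 0 zero

theorem TermDvd.refl (v : α × κ) : TermDvd v v := ⟨rfl, 0, (add_zero _).symm⟩

theorem TermDvd.trans {u v w : α × κ} (h : TermDvd u v) (h' : TermDvd v w) : TermDvd u w := by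
  obtain ⟨h1, a, ha⟩ := h
  obtain ⟨h2, b, hb⟩ := h'
  exact ⟨h1.trans h2, a + b, by rw [hb, ha, add_assoc]⟩

theorem termDvd_iff {v w : α × κ} : TermDvd v w ↔ ∃ t, w = (t + v.1, v.2) := by
  constructor
  · rintro ⟨h, u, hu⟩
    exact ⟨u, Prod.ext (hu.trans (add_comm _ _)) h.symm⟩
  · rintro ⟨t, rfl⟩
    exact ⟨rfl, t, add_comm _ _⟩

end Basic

/-! ### Leading terms and divisibility. -/

namespace TermOrder

variable {α κ K : Type*} [AddCommMonoid α] [LinearOrder κ] [Nonempty κ] [Field K]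

theorem le_of_termDvd (o : TermOrder α κ) {v w : α × κ} (h : TermDvd v w) : o.ordT.le v w := by
  obtain ⟨h2, u, hu⟩ := h
  refine o.ord_termI _ _ ?_ h2.le
  have h3 := o.add_mono 0 u v.1 (o.zero_min u)
  rwa [zero_add, add_comm u, ← hu] at h3

theorem termDvd_antisymm (o : TermOrder α κ) {v w : α × κ} (h : TermDvd v w)
    (h' : TermDvd w v) : v = w :=
  o.ordT.le_antisymm _ _ (o.le_of_termDvd h) (o.le_of_termDvd h')

theorem lt_eq (o : TermOrder α κ) {p : VecPoly α κ K} {v : α × κ} (hv : coeff p v ≠ 0)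
    (h : ∀ w, coeff p w ≠ 0 → o.ordT.le w v) : o.lt p = v :=
  o.ordT.le_antisymm _ _ (h _ (o.coeff_lt_ne_zero (ne_zero_of_coeff hv))) (o.le_lt hv)

section Cancel

variable [IsCancelAdd α]

theorem le_of_coeff_monomMult (o : TermOrder α κ) {c : K} {t : α} {f : VecPoly α κ K}
    {w : α × κ} (h : coeff (monomMult c t f) w ≠ 0) :
    o.ordT.le w (t + (o.lt f).1, (o.lt f).2) := by
  obtain ⟨v, rfl, hv⟩ := exists_of_coeff_monomMult h
  exact o.stimes_mono _ _ _ (o.le_lt hv)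

/-! ### The reduction relation -/

theorem Red.sub_mem {o : TermOrder α κ} {F : Set (VecPoly α κ K)} {p q : VecPoly α κ K}
    (h : Relation.ReflTransGen (o.Red F) p q) : p - q ∈ pmdl F := by
  induction h with
  | refl => simp
  | tail _ h ih =>
    obtain ⟨f, hf, t, -, -, rfl⟩ := h
    rw [← sub_add]
    exact Submodule.add_mem _ ih (monomMult_mem (Submodule.subset_span hf) _ _)

theorem not_red_zero (o : TermOrder α κ) {F : Set (VecPoly α κ K)} {q : VecPoly α κ K} :
    ¬ o.Red F 0 q := by
  rintro ⟨f, -, t, -, h, -⟩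
  exact h (coeff_zero _)

theorem isRed_of_termDvd (o : TermOrder α κ) {F : Set (VecPoly α κ K)} {p f : VecPoly α κ K}
    {v : α × κ} (hf : f ∈ F) (hf0 : f ≠ 0) (hv : coeff p v ≠ 0) (h : TermDvd (o.lt f) v) :
    o.IsRed F p := by
  obtain ⟨t, rfl⟩ := termDvd_iff.1 h
  exact ⟨_, f, hf, t, hf0, hv, rfl⟩

/-- Adding a monomial multiple of an element of `F` does not leave the joinability class. -/
theorem join_add_monomMult (o : TermOrder α κ) {F : Set (VecPoly α κ K)} {f : VecPoly α κ K}
    (hf : f ∈ F) (q : VecPoly α κ K) (c : K) (t : α) :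
    Relation.Join (Relation.ReflTransGen (o.Red F)) (q + monomMult c t f) q := by
  by_cases hf0 : f = 0
  · subst hf0
    exact ⟨q, by simp [monomMult]; rfl, .refl⟩
  have hlc : coeff f (o.lt f) ≠ 0 := o.coeff_lt_ne_zero hf0
  -- At most one step clears the coefficient at `t` times the leading term of `f`. Clearing it in
  -- `q` and in `q + monomMult c t f` gives the same result.
  have key : ∀ p : VecPoly α κ K, Relation.ReflTransGen (o.Red F) p
      (p - monomMult (coeff p (t + (o.lt f).1, (o.lt f).2) / o.lc f) t f) := by
    intro p
    by_cases h : coeff p (t + (o.lt f).1, (o.lt f).2) = 0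
    · rw [h, zero_div, monomMult_zero_coeff, sub_zero]
    · exact .single ⟨f, hf, t, hf0, h, rfl⟩
  refine ⟨_, ?_, key q⟩
  convert key (q + monomMult c t f) using 1
  rw [coeff_add, coeff_monomMult, add_sub_assoc, monomMult_sub_monomMult, sub_eq_add_neg]
  congr 1
  rw [← zero_sub, ← monomMult_zero_coeff t f, monomMult_sub_monomMult]
  congr 1
  rw [lc]
  field_simp
  ring

/-- Confluence makes joinability transitive, so by `join_add_monomMult` joinability with `0`
survives building `p` from multiples of generators. As `0` is irreducible, being joinable with `0`
means reducing to it. -/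
theorem IsGroebnerBasis.red_zero {o : TermOrder α κ} {G : Set (VecPoly α κ K)}
    (hG : o.IsGroebnerBasis G) {p : VecPoly α κ K} (hp : p ∈ pmdl G) :
    Relation.ReflTransGen (o.Red G) p 0 := by
  have hj : Relation.Join (Relation.ReflTransGen (o.Red G)) p 0 := by
    refine pmdl_induction (P := fun p => Relation.Join (Relation.ReflTransGen (o.Red G)) p 0)
      ⟨0, .refl, .refl⟩ ?_ hp
    rintro q c t f hf ⟨y, hy, hy0⟩
    obtain ⟨x, hx, hxq⟩ := o.join_add_monomMult hf q c t
    obtain ⟨z, hxz, hyz⟩ := hG q x y hxq hy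
    exact ⟨z, hx.trans hxz, hy0.trans hyz⟩
  obtain ⟨z, hz, h0⟩ := hj
  rcases h0.cases_head with rfl | ⟨_, h, -⟩
  · exact hz
  · exact absurd h o.not_red_zero

/-- A step at a smaller term leaves the leading term intact, so on the way to `0` some step must act
at the leading term itself. -/
theorem exists_termDvd_of_red_zero (o : TermOrder α κ) {F : Set (VecPoly α κ K)}
    {p : VecPoly α κ K} (h : Relation.ReflTransGen (o.Red F) p 0) (hp : p ≠ 0) :
    ∃ f ∈ F, f ≠ 0 ∧ TermDvd (o.lt f) (o.lt p) := by
  induction h using Relation.ReflTransGen.head_induction_on with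
  | refl => exact absurd rfl hp
  | head hpq _ ih =>
    rename_i p q _
    obtain ⟨f, hf, t, hf0, hc, hq⟩ := hpq
    by_cases hv : (t + (o.lt f).1, (o.lt f).2) = o.lt p
    · exact ⟨f, hf, hf0, termDvd_iff.2 ⟨t, hv.symm⟩⟩
    have hle := o.le_lt hc
    have hqp : coeff q (o.lt p) = coeff p (o.lt p) := by
      rw [hq, coeff_sub, sub_eq_self]
      by_contra hne
      exact hv (o.ordT.le_antisymm _ _ hle (o.le_of_coeff_monomMult hne))
    have hlt : o.lt q = o.lt p := by
      refine o.lt_eq (by rw [hqp]; exact o.coeff_lt_ne_zero hp) fun w hw => ?_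
      by_cases hpw : coeff p w = 0
      · rw [hq, coeff_sub, hpw, zero_sub, neg_ne_zero] at hw
        exact o.ordT.le_trans _ _ _ (o.le_of_coeff_monomMult hw) hle
      · exact o.le_lt hpw
    rw [← hlt]
    exact ih (ne_zero_of_coeff (by rw [hqp]; exact o.coeff_lt_ne_zero hp))

theorem IsGroebnerBasis.exists_termDvd {o : TermOrder α κ} {G : Set (VecPoly α κ K)}
    (hG : o.IsGroebnerBasis G) {p : VecPoly α κ K} (hp : p ∈ pmdl G) (hp0 : p ≠ 0) :
    ∃ g ∈ G, g ≠ 0 ∧ TermDvd (o.lt g) (o.lt p) :=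
  o.exists_termDvd_of_red_zero (hG.red_zero hp) hp0

/-! ### Uniqueness of reduced Gröbner bases -/

theorem IsReducedGB.eq_of_termDvd {o : TermOrder α κ} {A : Set (VecPoly α κ K)}
    (hA : o.IsReducedGB A) {a b : VecPoly α κ K} (ha : a ∈ A) (hb : b ∈ A) {v : α × κ}
    (hv : coeff b v ≠ 0) (h : TermDvd (o.lt a) v) : a = b := by
  by_contra hne
  exact hA.isAutoReduced b hb (o.isRed_of_termDvd ⟨ha, hne⟩
    (fun h0 => hA.zero_notMem (h0 ▸ ha)) hv h)

/-- Some `b ∈ A` has a leading term dividing that of `p`. If this term occurred in `a`,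
auto-reducedness would force `b = a`, and the leading term of `a` could not exceed that of `p`. -/
theorem IsReducedGB.coeff_eq_zero {o : TermOrder α κ} {A : Set (VecPoly α κ K)}
    (hA : o.IsReducedGB A) {a p : VecPoly α κ K} (ha : a ∈ A) (hp : p ∈ pmdl A) (hp0 : p ≠ 0)
    (hne : ¬ o.ordT.le (o.lt a) (o.lt p)) : coeff a (o.lt p) = 0 := by
  by_contra h
  obtain ⟨b, hb, -, hdvd⟩ := hA.isGroebnerBasis.exists_termDvd hp hp0
  obtain rfl := hA.eq_of_termDvd hb ha h hdvd
  exact hne (o.le_of_termDvd hdvd)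

theorem IsReducedGB.subset {o : TermOrder α κ} {A B : Set (VecPoly α κ K)}
    (hA : o.IsReducedGB A) (hB : o.IsReducedGB B) (h : pmdl A = pmdl B) : A ⊆ B := by
  intro a ha
  have hmem : a ∈ pmdl A := Submodule.subset_span ha
  have ha0 : a ≠ 0 := fun h0 => hA.zero_notMem (h0 ▸ ha)
  obtain ⟨b, hb, hb0, hba⟩ := hB.isGroebnerBasis.exists_termDvd (h ▸ hmem) ha0
  have hbm : b ∈ pmdl A := h ▸ Submodule.subset_span hb
  obtain ⟨a', ha', -, hab⟩ := hA.isGroebnerBasis.exists_termDvd hbm hb0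
  -- Passing from `A` to `B` and back must return to the starting element, so the divisibilities are
  -- mutual.
  obtain rfl := hA.eq_of_termDvd ha' ha (o.coeff_lt_ne_zero ha0) (hab.trans hba)
  have hlt : o.lt b = o.lt a' := o.termDvd_antisymm hba hab
  by_cases hs : a' - b = 0
  · rwa [sub_eq_zero.1 hs]
  have hsm : a' - b ∈ pmdl A := Submodule.sub_mem _ hmem hbm
  have hc := o.coeff_lt_ne_zero hs
  -- Both elements are monic with the same leading term, so the leading monomials cancel in the
  -- difference.
  have hnle : ¬ o.ordT.le (o.lt a') (o.lt (a' - b)) := by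
    intro hle
    have hor : coeff a' (o.lt (a' - b)) ≠ 0 ∨ coeff b (o.lt (a' - b)) ≠ 0 := by
      by_contra! hcon
      rw [coeff_sub, hcon.1, hcon.2, sub_zero] at hc
      exact hc rfl
    have hle' : o.ordT.le (o.lt (a' - b)) (o.lt a') :=
      hor.elim o.le_lt fun h => hlt ▸ o.le_lt h
    rw [o.ordT.le_antisymm _ _ hle' hle, coeff_sub] at hc
    apply hc
    have h1 : coeff a' (o.lt a') = 1 := hA.monic a' ha
    have h2 : coeff b (o.lt b) = 1 := hB.monic b hb
    rw [h1, ← hlt, h2, sub_self]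
  rw [coeff_sub, hA.coeff_eq_zero ha hsm hs hnle,
    hB.coeff_eq_zero hb (h ▸ hsm) hs (hlt ▸ hnle), sub_zero] at hc
  exact absurd rfl hc

end Cancel

/-! ### Total reduction computes normal forms -/

section Trd

variable [GradedDicksonPowerprod α]

theorem findDvd_eq_none (o : TermOrder α κ) {fs : List (VecPoly α κ K)} {v : α × κ} :
    o.findDvd fs v = none ↔ ∀ f ∈ fs, f ≠ 0 → ¬ TermDvd (o.lt f) v := by
  simp [findDvd]

theorem trd_zero (o : TermOrder α κ) (fs : List (VecPoly α κ K)) : o.trd fs 0 = 0 := by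
  rw [trd, dif_pos rfl]

theorem trd_of_some (o : TermOrder α κ) {fs : List (VecPoly α κ K)} {p f : VecPoly α κ K}
    (hp : p ≠ 0) (hf : o.findDvd fs (o.lt p) = some f) :
    o.trd fs p = o.trd fs (o.trdStep fs p) := by
  rw [trd, dif_neg hp, hf, Option.isSome_some, if_pos rfl, zero_add]

theorem trd_of_none (o : TermOrder α κ) {fs : List (VecPoly α κ K)} {p : VecPoly α κ K}
    (hp : p ≠ 0) (hf : o.findDvd fs (o.lt p) = none) :
    o.trd fs p = monomial (o.lc p) (o.lt p) + o.trd fs (o.trdStep fs p) := by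
  rw [trd, dif_neg hp, hf, Option.isSome_none, if_neg Bool.false_ne_true]

theorem trd_induction (o : TermOrder α κ) (fs : List (VecPoly α κ K))
    {P : VecPoly α κ K → Prop} (zero : P 0) (step : ∀ p, p ≠ 0 → P (o.trdStep fs p) → P p)
    (p : VecPoly α κ K) : P p := by
  induction p using (o.wellFounded_trdStep fs).induction with
  | _ p ih =>
    by_cases hp : p = 0
    · exact hp ▸ zero
    · exact step p hp (ih _ ⟨hp, rfl⟩)

/-- Here `r` is the part already moved to the result. None of its terms lies at or below a term of
`p`, so each step on `p` is also a reduction step of `r + p`. -/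
theorem reflTransGen_add_trd (o : TermOrder α κ) (fs : List (VecPoly α κ K))
    (p : VecPoly α κ K) :
    ∀ r : VecPoly α κ K, (∀ w, coeff p w ≠ 0 → ∀ v, o.ordT.le v w → coeff r v = 0) →
      Relation.ReflTransGen (o.Red {x | x ∈ fs}) (r + p) (r + o.trd fs p) := by
  induction p using o.trd_induction fs with
  | zero => intro r _; rw [trd_zero]
  | step p hp ih =>
    intro r hr
    have hr0 := hr _ (o.coeff_lt_ne_zero hp)
    cases hf : o.findDvd fs (o.lt p) with
    | some f =>
      rw [o.trd_of_some hp hf]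
      refine .head ?_ (ih r fun w hw v hv =>
        hr0 v (o.ordT.le_trans _ _ _ hv (o.of_mem_trdStep hw).1.1))
      obtain ⟨hfs, hf0, hcomp, hadds⟩ := o.findDvd_spec hf
      have hltp : (quot (o.lt p).1 (o.lt f).1 + (o.lt f).1, (o.lt f).2) = o.lt p :=
        Prod.ext (quot_spec hadds) hcomp
      have hc : coeff (r + p) (o.lt p) = o.lc p := by
        rw [coeff_add, hr0 _ (o.ordT.le_refl _), zero_add, lc]
      refine ⟨f, hfs, quot (o.lt p).1 (o.lt f).1, hf0, ?_, ?_⟩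
      · rw [hltp, hc]
        exact o.coeff_lt_ne_zero hp
      · rw [hltp, hc, trdStep, hf, add_sub_assoc]
    | none =>
      have htail : o.trdStep fs p = p - monomial (o.lc p) (o.lt p) := by
        rw [trdStep, hf, tail]
      have h1 : r + p = r + monomial (o.lc p) (o.lt p) + o.trdStep fs p := by
        rw [htail]
        abel
      rw [o.trd_of_none hp hf, ← add_assoc, h1]
      refine ih _ fun w hw v hv => ?_
      obtain ⟨⟨hle, hne⟩, -⟩ := o.of_mem_trdStep hw
      rw [coeff_add, hr0 v (o.ordT.le_trans _ _ _ hv hle), zero_add]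
      refine coeff_monomial_ne _ ?_
      rintro rfl
      exact hne (o.ordT.le_antisymm _ _ hle hv)

theorem reflTransGen_trd (o : TermOrder α κ) (fs : List (VecPoly α κ K)) (p : VecPoly α κ K) :
    Relation.ReflTransGen (o.Red {x | x ∈ fs}) p (o.trd fs p) := by
  simpa using o.reflTransGen_add_trd fs p 0 fun _ _ v _ => coeff_zero v

theorem sub_trd_mem (o : TermOrder α κ) (fs : List (VecPoly α κ K)) (p : VecPoly α κ K) :
    p - o.trd fs p ∈ pmdl {x | x ∈ fs} :=
  Red.sub_mem (o.reflTransGen_trd fs p)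

theorem le_lt_of_coeff_trd (o : TermOrder α κ) (fs : List (VecPoly α κ K))
    (p : VecPoly α κ K) :
    ∀ v, coeff (o.trd fs p) v ≠ 0 → o.ordT.le v (o.lt p) := by
  induction p using o.trd_induction fs with
  | zero => intro v hv; rw [trd_zero, coeff_zero] at hv; exact absurd rfl hv
  | step p hp ih =>
    intro v hv
    by_cases hs : coeff (o.trd fs (o.trdStep fs p)) v = 0
    · cases hf : o.findDvd fs (o.lt p) with
      | some f => rw [o.trd_of_some hp hf] at hv; exact absurd hs hv
      | none =>
        rw [o.trd_of_none hp hf, coeff_add, hs, add_zero] at hv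
        by_cases h : o.lt p = v
        · rw [h]
          exact o.ordT.le_refl _
        · exact absurd (coeff_monomial_ne _ h) hv
    · have hne : o.trdStep fs p ≠ 0 := by
        intro h0
        rw [h0, trd_zero, coeff_zero] at hs
        exact hs rfl
      exact o.ordT.le_trans _ _ _ (ih v hs)
        (o.of_mem_trdStep (o.coeff_lt_ne_zero hne)).1.1

theorem not_termDvd_of_coeff_trd (o : TermOrder α κ) {fs : List (VecPoly α κ K)}
    (p : VecPoly α κ K) {f : VecPoly α κ K} (hf : f ∈ fs) (hf0 : f ≠ 0) :
    ∀ v, coeff (o.trd fs p) v ≠ 0 → ¬ TermDvd (o.lt f) v := by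
  induction p using o.trd_induction fs with
  | zero => intro v hv; rw [trd_zero, coeff_zero] at hv; exact absurd rfl hv
  | step p hp ih =>
    intro v hv
    by_cases hs : coeff (o.trd fs (o.trdStep fs p)) v = 0
    · cases hf' : o.findDvd fs (o.lt p) with
      | some f => rw [o.trd_of_some hp hf'] at hv; exact absurd hs hv
      | none =>
        rw [o.trd_of_none hp hf', coeff_add, hs, add_zero] at hv
        by_cases h : o.lt p = v
        · exact h ▸ o.findDvd_eq_none.1 hf' f hf hf0
        · exact absurd (coeff_monomial_ne _ h) hv
    · exact ih v hs

theorem lt_trd (o : TermOrder α κ) {fs : List (VecPoly α κ K)} {p : VecPoly α κ K} (hp : p ≠ 0)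
    (h : ∀ f ∈ fs, f ≠ 0 → ¬ TermDvd (o.lt f) (o.lt p)) :
    o.trd fs p ≠ 0 ∧ o.lt (o.trd fs p) = o.lt p := by
  have hf := o.findDvd_eq_none.2 h
  have hz : coeff (o.trd fs (o.trdStep fs p)) (o.lt p) = 0 := by
    by_contra hne
    have hs : o.trdStep fs p ≠ 0 := by
      intro h0
      rw [h0, trd_zero, coeff_zero] at hne
      exact hne rfl
    obtain ⟨⟨hle, hne'⟩, -⟩ := o.of_mem_trdStep (o.coeff_lt_ne_zero hs)
    exact hne' (o.ordT.le_antisymm _ _ hle (o.le_lt_of_coeff_trd fs _ _ hne))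
  have hc : coeff (o.trd fs p) (o.lt p) ≠ 0 := by
    rw [o.trd_of_none hp hf, coeff_add, coeff_monomial_self, hz, add_zero]
    exact o.coeff_lt_ne_zero hp
  exact ⟨ne_zero_of_coeff hc, o.lt_eq hc (o.le_lt_of_coeff_trd fs p)⟩

/-! ### Finite sets whose leading terms divide all leading terms of a submodule -/

section Criterion

variable {o : TermOrder α κ} {gs : List (VecPoly α κ K)}
  {N : Submodule (AddMonoidAlgebra K α) (VecPoly α κ K)}

theorem trd_eq_zero_of_forall_termDvd
    (hN : ∀ p ∈ N, p ≠ 0 → ∃ g ∈ gs, g ≠ 0 ∧ TermDvd (o.lt g) (o.lt p))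
    (hgs : pmdl {x | x ∈ gs} ≤ N) {p : VecPoly α κ K} (hp : p ∈ N) : o.trd gs p = 0 := by
  by_contra h0
  have hmem : o.trd gs p ∈ N := by
    have := N.sub_mem hp (hgs (o.sub_trd_mem gs p))
    rwa [sub_sub_cancel] at this
  obtain ⟨g, hg, hg0, hdvd⟩ := hN _ hmem h0
  exact o.not_termDvd_of_coeff_trd p hg hg0 _ (o.coeff_lt_ne_zero h0) hdvd

theorem pmdl_eq_of_forall_termDvd
    (hN : ∀ p ∈ N, p ≠ 0 → ∃ g ∈ gs, g ≠ 0 ∧ TermDvd (o.lt g) (o.lt p))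
    (hgs : pmdl {x | x ∈ gs} ≤ N) : pmdl {x | x ∈ gs} = N := by
  refine le_antisymm hgs fun p hp => ?_
  have := o.sub_trd_mem gs p
  rwa [trd_eq_zero_of_forall_termDvd hN hgs hp, sub_zero] at this

/-- The total reductions of `q` and `r` differ by an element of the submodule. Were the difference
non-zero, its leading term would occur in one of them and be divisible by a leading term of `gs`,
which normal forms exclude. -/
theorem isGroebnerBasis_of_forall_termDvd
    (h : ∀ p ∈ pmdl {x | x ∈ gs}, p ≠ 0 → ∃ g ∈ gs, g ≠ 0 ∧ TermDvd (o.lt g) (o.lt p)) :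
    o.IsGroebnerBasis {x | x ∈ gs} := by
  intro p q r hq hr
  refine ⟨o.trd gs q, o.reflTransGen_trd gs q, ?_⟩
  suffices heq : o.trd gs q = o.trd gs r by
    rw [heq]
    exact o.reflTransGen_trd gs r
  by_contra hne
  have hs : o.trd gs q - o.trd gs r ≠ 0 := sub_ne_zero.2 hne
  have hmem : o.trd gs q - o.trd gs r ∈ pmdl {x | x ∈ gs} := by
    have h1 := Submodule.add_mem _ (Red.sub_mem hq) (o.sub_trd_mem gs q)
    have h2 := Submodule.add_mem _ (Red.sub_mem hr) (o.sub_trd_mem gs r)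
    convert Submodule.sub_mem _ h2 h1 using 1
    abel
  obtain ⟨g, hg, hg0, hdvd⟩ := h _ hmem hs
  have hc := o.coeff_lt_ne_zero hs
  have hor : coeff (o.trd gs q) (o.lt (o.trd gs q - o.trd gs r)) ≠ 0 ∨
      coeff (o.trd gs r) (o.lt (o.trd gs q - o.trd gs r)) ≠ 0 := by
    by_contra! hcon
    rw [coeff_sub, hcon.1, hcon.2, sub_zero] at hc
    exact hc rfl
  rcases hor with h' | h' <;> exact o.not_termDvd_of_coeff_trd _ hg hg0 _ h' hdvd

end Criterion

end Trd

/-! ### The algorithm -/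

section Algorithm

/-- The hypothesis `hys` records the test that each kept element passed against the unprocessed
ones; with the later test of `x` against `ys` it gives incomparability in both directions. A dropped
element has a divisor still present, so by transitivity it has one that survives. -/
theorem filterMinAux_spec (o : TermOrder α κ) (xs ys : List (VecPoly α κ K))
    (hys : ∀ y ∈ ys, ∀ x ∈ xs, ¬ TermDvd (o.lt x) (o.lt y))
    (hp : (ys.map o.lt).Pairwise fun v w => ¬ TermDvd v w ∧ ¬ TermDvd w v) :
    (∀ z ∈ o.filterMinAux xs ys, z ∈ xs ++ ys) ∧
    ((o.filterMinAux xs ys).map o.lt).Pairwise (fun v w => ¬ TermDvd v w ∧ ¬ TermDvd w v) ∧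
    ∀ x ∈ xs ++ ys, ∃ z ∈ o.filterMinAux xs ys, TermDvd (o.lt z) (o.lt x) := by
  induction xs generalizing ys with
  | nil => exact ⟨fun z hz => hz, hp, fun x hx => ⟨x, hx, .refl _⟩⟩
  | cons x xs ih =>
    rw [filterMinAux]
    split_ifs with h
    · obtain ⟨h1, h2, h3⟩ := ih ys (fun y hy z hz => hys y hy z (List.mem_cons_of_mem _ hz)) hp
      refine ⟨fun z hz => List.mem_cons_of_mem _ (h1 z hz), h2, fun w hw => ?_⟩
      rcases List.mem_cons.1 hw with rfl | hw
      · obtain ⟨y, hy, hyw⟩ := h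
        obtain ⟨z, hz, hzy⟩ := h3 y hy
        exact ⟨z, hz, hzy.trans hyw⟩
      · exact h3 w hw
    · push Not at h
      have hys' : ∀ y ∈ x :: ys, ∀ z ∈ xs, ¬ TermDvd (o.lt z) (o.lt y) := by
        intro y hy z hz
        rcases List.mem_cons.1 hy with rfl | hy
        · exact h z (List.mem_append_left _ hz)
        · exact hys y hy z (List.mem_cons_of_mem _ hz)
      have hp' : ((x :: ys).map o.lt).Pairwise fun v w => ¬ TermDvd v w ∧ ¬ TermDvd w v := by
        rw [List.map_cons, List.pairwise_cons]
        refine ⟨fun v hv => ?_, hp⟩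
        obtain ⟨y, hy, rfl⟩ := List.mem_map.1 hv
        exact ⟨hys y hy x List.mem_cons_self, h y (List.mem_append_right _ hy)⟩
      obtain ⟨h1, h2, h3⟩ := ih (x :: ys) hys' hp'
      have hperm : (xs ++ x :: ys).Perm (x :: xs ++ ys) := List.perm_middle
      exact ⟨fun z hz => hperm.mem_iff.1 (h1 z hz), h2, fun w hw => h3 w (hperm.mem_iff.2 hw)⟩

theorem compMinBasis_spec (o : TermOrder α κ) (xs : List (VecPoly α κ K)) :
    (∀ z ∈ o.compMinBasis xs, z ∈ xs ∧ z ≠ 0) ∧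
    ((o.compMinBasis xs).map o.lt).Pairwise (fun v w => ¬ TermDvd v w ∧ ¬ TermDvd w v) ∧
    ∀ x ∈ xs, x ≠ 0 → ∃ z ∈ o.compMinBasis xs, TermDvd (o.lt z) (o.lt x) := by
  classical
  obtain ⟨h1, h2, h3⟩ := o.filterMinAux_spec (xs.filter fun x => decide (x ≠ 0)) []
    (by simp) (by simp)
  refine ⟨fun z hz => ?_, h2, fun x hx hx0 => h3 x ?_⟩
  · simpa using h1 z hz
  · simpa using ⟨hx, hx0⟩

variable [GradedDicksonPowerprod α]

/-- The leading terms of a list in which no leading term divides another one stay the same when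
the elements are replaced by their total reductions, and every term of a result is reduced with
respect to the leading terms of the others. -/
theorem compRedBasisAux_spec (o : TermOrder α κ) (xs ys : List (VecPoly α κ K))
    (h0 : ∀ x ∈ xs ++ ys, x ≠ 0)
    (hp : ((xs ++ ys).map o.lt).Pairwise fun v w => ¬ TermDvd v w ∧ ¬ TermDvd w v)
    (hys : ∀ y ∈ ys, ∀ w ∈ (xs ++ ys).map o.lt, w ≠ o.lt y →
      ∀ v, coeff y v ≠ 0 → ¬ TermDvd w v) :
    ((o.compRedBasisAux xs ys).map o.lt).Perm ((xs ++ ys).map o.lt) ∧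
    (∀ z ∈ o.compRedBasisAux xs ys, z ≠ 0) ∧
    pmdl {x | x ∈ o.compRedBasisAux xs ys} = pmdl {x | x ∈ xs ++ ys} ∧
    ∀ z ∈ o.compRedBasisAux xs ys, ∀ w ∈ (xs ++ ys).map o.lt, w ≠ o.lt z →
      ∀ v, coeff z v ≠ 0 → ¬ TermDvd w v := by
  induction xs generalizing ys with
  | nil => exact ⟨.refl _, h0, rfl, hys⟩
  | cons x xs ih =>
    rw [compRedBasisAux]
    rw [List.cons_append, List.map_cons, List.pairwise_cons] at hp
    obtain ⟨hx, hp⟩ := hp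
    have h0' : ∀ f ∈ xs ++ ys, f ≠ 0 := fun f hf => h0 f (List.mem_cons_of_mem _ hf)
    obtain ⟨hne, hlt⟩ := o.lt_trd (h0 x List.mem_cons_self)
      fun f hf _ => (hx _ (List.mem_map_of_mem hf)).2
    have hsub := o.sub_trd_mem (xs ++ ys) x
    have hirr : ∀ w ∈ (xs ++ ys).map o.lt, ∀ v, coeff (o.trd (xs ++ ys) x) v ≠ 0 →
        ¬ TermDvd w v := by
      intro w hw v hv
      obtain ⟨f, hf, rfl⟩ := List.mem_map.1 hw
      exact o.not_termDvd_of_coeff_trd x hf (h0' f hf) v hv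
    generalize o.trd (xs ++ ys) x = x' at *
    have hperm : (xs ++ x' :: ys).Perm (x' :: (xs ++ ys)) := List.perm_middle
    have hmap : ((xs ++ x' :: ys).map o.lt).Perm ((x :: xs ++ ys).map o.lt) := by
      have := hperm.map o.lt
      rwa [List.map_cons, hlt] at this
    have hne' : ∀ z ∈ xs ++ x' :: ys, z ≠ 0 := by
      intro z hz
      rcases List.mem_cons.1 (hperm.mem_iff.1 hz) with rfl | hz
      · exact hne
      · exact h0' z hz
    have hp' : ((xs ++ x' :: ys).map o.lt).Pairwise fun v w => ¬ TermDvd v w ∧ ¬ TermDvd w v := by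
      -- The relation is stated symmetrically so that it is invariant under permutations.
      rw [hmap.pairwise_iff fun h => h.symm]
      exact List.pairwise_cons.2 ⟨hx, hp⟩
    have hys' : ∀ y ∈ x' :: ys, ∀ w ∈ (xs ++ x' :: ys).map o.lt, w ≠ o.lt y →
        ∀ v, coeff y v ≠ 0 → ¬ TermDvd w v := by
      intro y hy w hw hwy v hv
      have hw' := hmap.mem_iff.1 hw
      rcases List.mem_cons.1 hy with rfl | hy
      · rcases List.mem_cons.1 hw' with rfl | hw'
        · exact absurd hlt.symm hwy
        · exact hirr w hw' v hv
      · exact hys y hy w hw' hwy v hv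
    obtain ⟨h1, h2, h3, h4⟩ := ih (x' :: ys) hne' hp' hys'
    refine ⟨h1.trans hmap, h2, h3.trans ?_, fun z hz w hw =>
      h4 z hz w (hmap.mem_iff.2 hw)⟩
    have hs1 : {y | y ∈ xs ++ x' :: ys} = insert x' {y | y ∈ xs ++ ys} := by
      ext y
      exact hperm.mem_iff.trans List.mem_cons
    have hs2 : {y | y ∈ x :: xs ++ ys} = insert x {y | y ∈ xs ++ ys} := by
      ext y
      exact List.mem_cons
    rw [hs1, hs2, pmdl, pmdl, Submodule.span_insert, Submodule.span_insert]
    refine le_antisymm (sup_le ?_ le_sup_right) (sup_le ?_ le_sup_right) <;>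
      rw [Submodule.span_singleton_le_iff_mem]
    · have := Submodule.sub_mem _ (Submodule.mem_sup_left (Submodule.mem_span_singleton_self x))
        (Submodule.mem_sup_right hsub)
      rwa [sub_sub_cancel] at this
    · have := Submodule.add_mem _ (Submodule.mem_sup_right hsub)
        (Submodule.mem_sup_left (Submodule.mem_span_singleton_self x'))
      rwa [sub_add_cancel] at this

theorem lc_ne_zero (o : TermOrder α κ) {p : VecPoly α κ K} (hp : p ≠ 0) : o.lc p ≠ 0 :=
  o.coeff_lt_ne_zero hp

theorem coeff_monic (o : TermOrder α κ) (p : VecPoly α κ K) (v : α × κ) :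
    coeff (o.monic p) v = 1 / o.lc p * coeff p v :=
  coeff_monomMult_zero _ _ _

theorem coeff_monic_ne_zero (o : TermOrder α κ) {p : VecPoly α κ K} (hp : p ≠ 0) {v : α × κ} :
    coeff (o.monic p) v ≠ 0 ↔ coeff p v ≠ 0 := by
  simp [coeff_monic, o.lc_ne_zero hp]

theorem lt_monic (o : TermOrder α κ) {p : VecPoly α κ K} (hp : p ≠ 0) :
    o.lt (o.monic p) = o.lt p :=
  o.lt_eq ((o.coeff_monic_ne_zero hp).2 (o.coeff_lt_ne_zero hp)) fun _ hw =>
    o.le_lt ((o.coeff_monic_ne_zero hp).1 hw)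

theorem monic_ne_zero (o : TermOrder α κ) {p : VecPoly α κ K} (hp : p ≠ 0) : o.monic p ≠ 0 :=
  ne_zero_of_coeff ((o.coeff_monic_ne_zero hp).2 (o.coeff_lt_ne_zero hp))

theorem lc_monic (o : TermOrder α κ) {p : VecPoly α κ K} (hp : p ≠ 0) : o.lc (o.monic p) = 1 := by
  rw [lc, o.lt_monic hp, coeff_monic]
  exact one_div_mul_cancel (o.lc_ne_zero hp)

theorem monomMult_lc_monic (o : TermOrder α κ) {p : VecPoly α κ K} (hp : p ≠ 0) :
    monomMult (o.lc p) 0 (o.monic p) = p := by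
  apply ext_coeff
  intro v
  rw [coeff_monomMult_zero, coeff_monic, ← mul_assoc, mul_one_div_cancel (o.lc_ne_zero hp),
    one_mul]

theorem pmdl_map_monic (o : TermOrder α κ) {zs : List (VecPoly α κ K)} (h0 : ∀ z ∈ zs, z ≠ 0) :
    pmdl {x | x ∈ zs.map o.monic} = pmdl {x | x ∈ zs} := by
  refine le_antisymm (Submodule.span_le.2 ?_) (Submodule.span_le.2 fun z hz => ?_)
  · intro x hx
    obtain ⟨z, hz, rfl⟩ := List.mem_map.1 hx
    exact monomMult_mem (Submodule.subset_span hz) _ _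
  · rw [← o.monomMult_lc_monic (h0 z hz)]
    exact monomMult_mem (Submodule.subset_span (List.mem_map_of_mem hz)) _ _

theorem compRedMonicBasis_spec (o : TermOrder α κ) {xs : List (VecPoly α κ K)}
    (hxs : o.IsGroebnerBasis {x | x ∈ xs}) :
    o.IsReducedGB {x | x ∈ o.compRedMonicBasis xs} ∧
      pmdl {x | x ∈ o.compRedMonicBasis xs} = pmdl {x | x ∈ xs} := by
  obtain ⟨hm1, hm2, hm3⟩ := o.compMinBasis_spec xs
  rw [compRedMonicBasis]
  have hdvd : ∀ p ∈ pmdl {x | x ∈ xs}, p ≠ 0 →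
      ∃ g ∈ o.compMinBasis xs, g ≠ 0 ∧ TermDvd (o.lt g) (o.lt p) := by
    intro p hp hp0
    obtain ⟨x, hx, hx0, hxp⟩ := hxs.exists_termDvd hp hp0
    obtain ⟨z, hz, hzx⟩ := hm3 x hx hx0
    exact ⟨z, hz, (hm1 z hz).2, hzx.trans hxp⟩
  have hpm := pmdl_eq_of_forall_termDvd hdvd (Submodule.span_mono fun z hz => (hm1 z hz).1)
  obtain ⟨hr1, hr2, hr3, hr4⟩ := o.compRedBasisAux_spec (o.compMinBasis xs) []
    (by simpa using fun z hz => (hm1 z hz).2) (by simpa using hm2) (by simp)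
  rw [List.append_nil] at hr1 hr3 hr4
  have hinj : ((o.compRedBasisAux (o.compMinBasis xs) []).map o.lt).Nodup := by
    refine hr1.nodup_iff.2 (hm2.imp ?_)
    rintro v _ h rfl
    exact h.1 (.refl v)
  -- Leading terms are pairwise distinct, so distinct elements have distinct leading terms.
  have hr4' : ∀ z ∈ o.compRedBasisAux (o.compMinBasis xs) [],
      ∀ y ∈ o.compRedBasisAux (o.compMinBasis xs) [], y ≠ z →
      ∀ v, coeff z v ≠ 0 → ¬ TermDvd (o.lt y) v := fun z hz y hy hyz =>
    hr4 z hz _ (hr1.mem_iff.1 (List.mem_map_of_mem hy)) fun h =>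
      hyz (List.inj_on_of_nodup_map hinj hy hz h)
  have hpm' := (hr3.trans hpm)
  rw [← hpm'] at hdvd ⊢
  replace hdvd : ∀ p ∈ pmdl {x | x ∈ o.compRedBasisAux (o.compMinBasis xs) []}, p ≠ 0 →
      ∃ g ∈ o.compRedBasisAux (o.compMinBasis xs) [], TermDvd (o.lt g) (o.lt p) := by
    intro p hp hp0
    obtain ⟨g, hg, -, h⟩ := hdvd p hp hp0
    obtain ⟨z, hz, hzg⟩ := List.mem_map.1 (hr1.mem_iff.2 (List.mem_map_of_mem (f := o.lt) hg))
    exact ⟨z, hz, hzg ▸ h⟩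
  generalize o.compRedBasisAux (o.compMinBasis xs) [] = zs at *
  have hpz := o.pmdl_map_monic hr2
  refine ⟨⟨isGroebnerBasis_of_forall_termDvd ?_, ?_, ?_, ?_⟩, hpz⟩
  · intro p hp hp0
    rw [hpz] at hp
    obtain ⟨g, hg, h⟩ := hdvd p hp hp0
    exact ⟨_, List.mem_map_of_mem hg, o.monic_ne_zero (hr2 g hg), by rwa [o.lt_monic (hr2 g hg)]⟩
  · rintro b hb ⟨-, f, ⟨hf, hfb⟩, t, -, hc, -⟩
    obtain ⟨z, hz, rfl⟩ := List.mem_map.1 hb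
    obtain ⟨y, hy, rfl⟩ := List.mem_map.1 hf
    rw [o.lt_monic (hr2 y hy), o.coeff_monic_ne_zero (hr2 z hz)] at hc
    refine hr4' z hz y hy ?_ _ hc (termDvd_iff.2 ⟨t, rfl⟩)
    rintro rfl
    exact hfb rfl
  · intro b hb
    obtain ⟨z, hz, rfl⟩ := List.mem_map.1 hb
    exact o.lc_monic (hr2 z hz)
  · intro hb
    obtain ⟨z, hz, h⟩ := List.mem_map.1 hb
    exact o.monic_ne_zero (hr2 z hz) h

end Algorithm

end TermOrder

/-! ### Splitting power-products along a grading -/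

section Split

variable {α : Type*} [AddCommMonoid α] [GradedDicksonPowerprod α]

/-- If `r` has no non-trivial divisor of degree at most `m`, then it is coprime to all `a` of
degree at most `m`: it divides `u` if it divides `u + a`. -/
theorem adds_of_adds_add {d : α → ℕ} (hd : IsDicksonGrading d) {m : ℕ} {r : α}
    (hr : ∀ e, Adds e r → d e ≤ m → e = 0) {u a : α} (ha : d a ≤ m) (h : Adds r (u + a)) :
    Adds r u := by
  obtain ⟨l, ⟨x, hx⟩, ⟨z, hz⟩, hl⟩ := GradedDicksonPowerprod.exists_lcm r a
  obtain ⟨y, hy⟩ := hl (r + a) ⟨a, rfl⟩ ⟨r, add_comm _ _⟩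
  have hay : a = x + y := by
    rw [hx, add_assoc] at hy
    exact add_left_cancel hy
  have hry : r = y + z := by
    rw [hz, add_comm r, add_assoc, add_comm z] at hy
    exact add_left_cancel hy
  -- With `l` the least common multiple, `r + a = l + y`, and `y` divides both `r` and `a`. So `y`
  -- is trivial and the least common multiple is the product `r + a`.
  have hy0 : y = 0 := by
    refine hr y ⟨z, hry⟩ (le_trans ?_ ha)
    rw [hay, hd.map_add]
    exact le_max_right _ _
  rw [hy0, add_zero] at hy
  obtain ⟨b, hb⟩ := hl (u + a) h ⟨u, add_comm _ _⟩
  refine ⟨b, add_right_cancel (b := a) ?_⟩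
  rw [hb, ← hy]
  abel

/-- Every power-product is the product of one of degree at most `m` and one without non-trivial
divisors of degree at most `m`. -/
theorem exists_split {κ : Type*} [LE κ] (o : TermOrder α κ) {d : α → ℕ}
    (hd : IsDicksonGrading d) {m : ℕ} (hm : d 0 ≤ m) (t : α) :
    ∃ r s, t = r + s ∧ d s ≤ m ∧ ∀ e, Adds e r → d e ≤ m → e = 0 := by
  have hadd : ∀ a b : α, o.ordP.le a (a + b) := fun a b => by
    have := o.add_mono 0 b a (o.zero_min b)
    rwa [zero_add, add_comm b] at this
  let _ := o.ordP
  -- The order extends divisibility, which is almost full in bounded degree, so a least cofactor `r`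
  -- exists. A divisor `e` of it of small degree could be moved into `s`, hence is trivial.
  have hwf : {r | d r ≤ d t}.IsWF := by
    refine Set.IsPWO.isWF fun f => ?_
    obtain ⟨i, j, hij, u, hu⟩ := hd.dickson (d t) f
    exact ⟨i, j, hij, (hadd _ u).trans_eq hu.symm⟩
  have hwf' : {r | ∃ s, t = r + s ∧ d s ≤ m}.IsWF := by
    refine hwf.mono ?_
    rintro r ⟨s, rfl, -⟩
    change d r ≤ d (r + s)
    rw [hd.map_add]
    exact le_max_left _ _
  have hne : {r | ∃ s, t = r + s ∧ d s ≤ m}.Nonempty := ⟨t, 0, (add_zero t).symm, hm⟩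
  obtain ⟨s, hs, hsm⟩ := hwf'.min_mem hne
  refine ⟨_, s, hs, hsm, ?_⟩
  rintro e ⟨r', hr'⟩ hem
  have hle := hwf'.min_le hne (a := r') ⟨e + s, ?_, ?_⟩
  · have heq : hwf'.min hne = r' := by
      refine le_antisymm hle ?_
      rw [hr', add_comm]
      exact hadd _ _
    rw [heq] at hr'
    exact add_right_cancel (b := r') (by rw [zero_add, ← hr'])
  · rw [hr'] at hs
    rw [hs]
    abel
  · rw [hd.map_add]
    exact max_le hem hsm

variable {κ K : Type*} [Field K]

/-- Let `r` have no non-trivial divisor of degree at most `m`. If the terms of the generators have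
degree at most `m`, then extracting from an element of the submodule the multiples by `r` of the
power-products of degree at most `m` yields an element of the submodule. -/
theorem exists_mem_pmdl_coeff_eq {d : α → ℕ} (hd : IsDicksonGrading d) {m : ℕ} {r : α}
    (hr : ∀ e, Adds e r → d e ≤ m → e = 0) {F : Set (VecPoly α κ K)}
    (hF : ∀ f ∈ F, ∀ v, coeff f v ≠ 0 → d v.1 ≤ m) {p : VecPoly α κ K} (hp : p ∈ pmdl F) :
    ∃ q ∈ pmdl F, ∀ v : α × κ,
      coeff q v = if d v.1 ≤ m then coeff p (r + v.1, v.2) else 0 := by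
  refine pmdl_induction (P := fun p => ∃ q ∈ pmdl F, ∀ v : α × κ,
      coeff q v = if d v.1 ≤ m then coeff p (r + v.1, v.2) else 0)
    ⟨0, Submodule.zero_mem _, by simp [coeff_zero]⟩ ?_ hp
  rintro p c u f hf ⟨q, hq, hqp⟩
  suffices h : ∃ q ∈ pmdl F, ∀ v : α × κ,
      coeff q v = if d v.1 ≤ m then coeff (monomMult c u f) (r + v.1, v.2) else 0 by
    obtain ⟨q', hq', hqp'⟩ := h
    refine ⟨q + q', Submodule.add_mem _ hq hq', fun v => ?_⟩
    rw [coeff_add, hqp, hqp', coeff_add]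
    split_ifs <;> simp
  by_cases hu : ∃ e, u = r + e ∧ d e ≤ m
  · obtain ⟨e, rfl, he⟩ := hu
    refine ⟨monomMult c e f, monomMult_mem (Submodule.subset_span hf) _ _, fun v => ?_⟩
    split_ifs with hv
    · have h1 : monomMult c (r + e) f = monomMult 1 r (monomMult c e f) := by
        rw [monomMult, monomMult, monomMult, smul_smul, AddMonoidAlgebra.single_mul_single,
          one_mul]
      rw [h1, coeff_monomMult, one_mul]
    · by_contra hne
      obtain ⟨w, rfl, hw⟩ := exists_of_coeff_monomMult hne
      apply hv
      rw [hd.map_add]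
      exact max_le he (hF f hf w hw)
  -- This multiple contributes nothing: an equality `r + v.1 = u + w.1` with `w` a term of `f` makes
  -- `r` divide `u` by coprimality, and the cofactor divides `v.1`, so it has degree at most `m`.
  · refine ⟨0, Submodule.zero_mem _, fun v => ?_⟩
    rw [coeff_zero]
    split_ifs with hv
    · by_contra hne
      obtain ⟨w, hw, hfw⟩ := exists_of_coeff_monomMult (Ne.symm hne)
      have h1 : r + v.1 = u + w.1 := congrArg Prod.fst hw
      obtain ⟨e, rfl⟩ := adds_of_adds_add hd hr (hF f hf w hfw) ⟨v.1, h1.symm⟩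
      refine hu ⟨e, rfl, le_trans ?_ hv⟩
      rw [add_assoc] at h1
      rw [add_left_cancel h1, hd.map_add]
      exact le_max_left _ _
    · rfl

end Split

/-! ### Existence of finite Gröbner bases. -/

namespace TermOrder

variable {α κ K : Type*} [AddCommMonoid α] [LinearOrder κ] [Nonempty κ] [Field K]
  [GradedDicksonPowerprod α]

/-- In a set of terms of bounded degree and with finitely many components, finitely many elements
suffice to divide all others. -/
theorem exists_finset_termDvd {d : α → ℕ} (hd : IsDicksonGrading d) (m : ℕ) (C : Finset κ)
    {W : Set (α × κ)} (hW : ∀ w ∈ W, d w.1 ≤ m ∧ w.2 ∈ C) :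
    ∃ T : Finset (α × κ), (∀ v ∈ T, v ∈ W) ∧ ∀ w ∈ W, ∃ v ∈ T, TermDvd v w := by
  by_contra! hcon
  -- If no finite subset suffices, choosing greedily gives a sequence in which no term divides a
  -- later one.
  obtain ⟨f, hf, hnd⟩ := exists_seq_of_forall_finset_exists (· ∈ W)
    (fun v w => ¬ TermDvd v w) hcon
  have hpre : IsPreorder {t : α // t ∈ {t | d t ≤ m}} (Subrel Adds (· ∈ {t | d t ≤ m})) :=
    { refl := fun a => ⟨0, (add_zero _).symm⟩
      trans := by
        rintro a b c ⟨u, hu⟩ ⟨v, hv⟩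
        exact ⟨u + v, by rw [hv, hu, add_assoc]⟩ }
  have hwqo := (show WellQuasiOrdered (Subrel Adds (· ∈ {t | d t ≤ m})) from hd.dickson m).prod
    (Finite.wellQuasiOrdered (α := C) Eq)
  obtain ⟨i, j, hij, h1, h2⟩ := hwqo fun n =>
    (⟨(f n).1, (hW _ (hf n)).1⟩, ⟨(f n).2, (hW _ (hf n)).2⟩)
  exact hnd i j hij ⟨congrArg Subtype.val h2, h1⟩

/-- Keeps leading terms within finitely many components even when `κ` is infinite. -/
theorem snd_mem_of_mem_pmdl {F : Set (VecPoly α κ K)} {C : Set κ}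
    (hF : ∀ f ∈ F, ∀ v, coeff f v ≠ 0 → v.2 ∈ C) {p : VecPoly α κ K} (hp : p ∈ pmdl F) :
    ∀ v, coeff p v ≠ 0 → v.2 ∈ C := by
  refine pmdl_induction (P := fun p => ∀ v, coeff p v ≠ 0 → v.2 ∈ C)
    (fun v hv => absurd (coeff_zero v) hv) ?_ hp
  intro q c t f hf hq v hv
  by_cases h : coeff q v = 0
  · rw [coeff_add, h, zero_add] at hv
    obtain ⟨w, rfl, hw⟩ := exists_of_coeff_monomMult hv
    exact hF f hf w hw
  · exact hq v h

/-- Finitely generated submodules have finite Gröbner bases. -/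
theorem exists_isGroebnerBasis (o : TermOrder α κ)
    {N : Submodule (AddMonoidAlgebra K α) (VecPoly α κ K)} (hN : N.FG) :
    ∃ gs : List (VecPoly α κ K), o.IsGroebnerBasis {x | x ∈ gs} ∧ pmdl {x | x ∈ gs} = N := by
  classical
  obtain ⟨F, rfl⟩ := hN
  obtain ⟨d, hd⟩ := GradedDicksonPowerprod.exists_grading (α := α)
  let T : Finset (α × κ) := F.biUnion keys
  -- Including `d 0` guarantees that the trivial splitting with `s = 0` is admissible.
  let m : ℕ := max (d 0) (T.sup fun v => d v.1)
  let C : Finset κ := T.image Prod.snd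
  have hT : ∀ f ∈ (F : Set (VecPoly α κ K)), ∀ v, coeff f v ≠ 0 → v ∈ T := fun f hf v hv =>
    Finset.mem_biUnion.2 ⟨f, hf, mem_keys.2 hv⟩
  have hFm : ∀ f ∈ (F : Set (VecPoly α κ K)), ∀ v, coeff f v ≠ 0 → d v.1 ≤ m :=
    fun f hf v hv => le_max_of_le_right
      (Finset.le_sup (f := fun v : α × κ => d v.1) (hT f hf v hv))
  have hFC : ∀ f ∈ (F : Set (VecPoly α κ K)), ∀ v, coeff f v ≠ 0 → v.2 ∈ (C : Set κ) :=
    fun f hf v hv => Finset.mem_image_of_mem _ (hT f hf v hv)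
  obtain ⟨L, hL, hLdvd⟩ := exists_finset_termDvd hd m C
    (W := {w | d w.1 ≤ m ∧ ∃ p ∈ pmdl (F : Set (VecPoly α κ K)), p ≠ 0 ∧ o.lt p = w}) (by
      rintro _ ⟨hw, p, hp, hp0, rfl⟩
      exact ⟨hw, snd_mem_of_mem_pmdl hFC hp _ (o.coeff_lt_ne_zero hp0)⟩)
  choose! g hg using fun v hv => (hL v hv).2
  have hmem : ∀ x ∈ L.toList.map g, x ∈ pmdl (F : Set (VecPoly α κ K)) := by
    intro x hx
    obtain ⟨v, hv, rfl⟩ := List.mem_map.1 hx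
    exact (hg v (Finset.mem_toList.1 hv)).1
  have hdvd : ∀ p ∈ pmdl (F : Set (VecPoly α κ K)), p ≠ 0 →
      ∃ x ∈ L.toList.map g, x ≠ 0 ∧ TermDvd (o.lt x) (o.lt p) := by
    intro p hp hp0
    obtain ⟨r, s, hrs, hs, hr⟩ := exists_split o hd (le_max_left _ _ : d 0 ≤ m) (o.lt p).1
    obtain ⟨q, hq, hqp⟩ := exists_mem_pmdl_coeff_eq hd hr hFm hp
    have hltp : o.lt p = (r + s, (o.lt p).2) := Prod.ext hrs rfl
    have hc : coeff q (s, (o.lt p).2) ≠ 0 := by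
      rw [hqp, if_pos hs, ← hltp]
      exact o.coeff_lt_ne_zero hp0
    have hq0 := ne_zero_of_coeff hc
    have hcq := o.coeff_lt_ne_zero hq0
    rw [hqp] at hcq
    have hle := o.stimes_mono _ _ r (o.le_lt hc)
    rw [← hltp] at hle
    have hqm : d (o.lt q).1 ≤ m := by
      by_contra h
      rw [if_neg h] at hcq
      exact hcq rfl
    rw [if_pos hqm] at hcq
    -- Multiplying the leading term of `q` by `r` gives a term of `p` that is at least the leading
    -- term of `p`, hence equal to it.
    have heq := o.ordT.le_antisymm _ _ hle (o.le_lt hcq)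
    obtain ⟨v, hv, hvq⟩ := hLdvd _ ⟨hqm, q, hq, hq0, rfl⟩
    obtain ⟨-, hgv0, hgv⟩ := hg v hv
    refine ⟨g v, List.mem_map_of_mem (Finset.mem_toList.2 hv), hgv0, ?_⟩
    rw [hgv]
    exact hvq.trans (termDvd_iff.2 ⟨r, heq⟩)
  have heq := pmdl_eq_of_forall_termDvd hdvd (Submodule.span_le.2 hmem)
  refine ⟨_, isGroebnerBasis_of_forall_termDvd ?_, heq⟩
  rwa [heq]

end TermOrder

end ModuleGB

/-! ### The main theorem. -/

theorem mainTheorem4 {α κ K : Type*} [AddCommMonoid α] [ModuleGB.GradedDicksonPowerprod α]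
    [LinearOrder κ] [WellFoundedLT κ] [Nonempty κ] [Field K] (o : ModuleGB.TermOrder α κ) :
    (∀ A B : Set (ModuleGB.VecPoly α κ K), o.IsReducedGB A → o.IsReducedGB B →
      ModuleGB.pmdl A = ModuleGB.pmdl B → A = B) ∧
    (∀ xs : List (ModuleGB.VecPoly α κ K), o.IsGroebnerBasis {x | x ∈ xs} →
      o.IsReducedGB {x | x ∈ o.compRedMonicBasis xs} ∧
      ModuleGB.pmdl {x | x ∈ o.compRedMonicBasis xs} = ModuleGB.pmdl {x | x ∈ xs}) ∧
    (∀ N : Submodule (AddMonoidAlgebra K α) (ModuleGB.VecPoly α κ K), N.FG →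
      ∃! G : Set (ModuleGB.VecPoly α κ K), o.IsReducedGB G ∧ ModuleGB.pmdl G = N) := by
  have huniq : ∀ A B : Set (ModuleGB.VecPoly α κ K), o.IsReducedGB A → o.IsReducedGB B →
      ModuleGB.pmdl A = ModuleGB.pmdl B → A = B := fun A B hA hB h =>
    Set.Subset.antisymm (hA.subset hB h) (hB.subset hA h.symm)
  refine ⟨huniq, fun xs hxs => o.compRedMonicBasis_spec hxs, fun N hN => ?_⟩
  obtain ⟨gs, hgs, hgN⟩ := o.exists_isGroebnerBasis hN
  obtain ⟨hred, hspan⟩ := o.compRedMonicBasis_spec hgs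
  exact ⟨_, ⟨hred, hspan.trans hgN⟩, fun G hG => huniq _ _ hG.1 hred
    (hG.2.trans (hspan.trans hgN).symm)⟩
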